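/- Let $\mathbb{K}$ be $\mathbb{R}$ or $\mathbb{C}$, and let all Banach spaces be over $\mathbb{K}$. A sequence $(x_j)_{j=1}^\infty$ in a Banach space $E$ is weakly $q$-summable if $(\varphi(x_j))_j\in l_q$ for every continuous linear functional $\varphi$ on $E$. For an integer $n\ge 1$, $p,q\in(0,\infty)$ and Banach spaces $E,F$, let $\mathcal{P}_{as(p;q)}({}^nE;F)$ be the set of continuous $n$-homogeneous polynomials $P:E\to F$ such that $\sum_j\|P(x_j)\|^p<\infty$ for every weakly $q$-summable sequence $(x_j)_j$ in $E$, and let $\mathcal{L}_{as(p;q)}({}^nE;F)$ be the set of continuous $n$-linear mappings $T:E\times\cdots\times E\to F$ such that $\sum_j\|T(x_j^{(1)},\dots,x_j^{(n)})\|^p<\infty$ for all weakly $q$-summable sequences $(x_j^{(1)})_j,\dots,(x_j^{(n)})_j$ in $E$. Theorem. Let $n\ge 1$ be an integer, let $1<r<p<\infty$, and let $X$ be a Banach space. (1) (Polynomial Extrapolation Theorem) If $$\mathcal{P}_{as(\frac pn;p)}({}^nX;l_p)=\mathcal{P}_{as(\frac rn;r)}({}^nX;l_p),$$ then for every Banach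 space $Y$ $$\mathcal{P}_{as(\frac pn;p)}({}^nX;Y)=\mathcal{P}_{as(\frac 1n;1)}({}^nX;Y).$$ (2) (Multilinear version) If $$\mathcal{L}_{as(\frac pn;p)}({}^nX;l_p)=\mathcal{L}_{as(\frac rn;r)}({}^nX;l_p),$$ then for every Banach space $Y$ $$\mathcal{L}_{as(\frac pn;p)}({}^nX;Y)=\mathcal{L}_{as(\frac 1n;1)}({}^nX;Y).$$ -/

import Mathlib

open scoped ENNReal

section SummingMaps

variable (𝕜 : Type*) [RCLike 𝕜]
  {E : Type*} [NormedAddCommGroup E] [NormedSpace 𝕜 E]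
  {F : Type*} [NormedAddCommGroup F] [NormedSpace 𝕜 F]

/-- A sequence in `E` is weakly `q`-summable (an element of `l_q^w(E)`) if its image under every
continuous linear functional belongs to the scalar sequence space `l_q`. -/
def WeaklySummableSeq (q : ℝ≥0∞) (x : ℕ → E) : Prop :=
  ∀ φ : StrongDual 𝕜 E, Memℓp (fun j => φ (x j)) q

/-- A map `P : E → F` is a continuous `n`-homogeneous polynomial if it is the restriction to the
diagonal of a continuous `n`-linear map. -/
def IsContinuousHomogeneousPolynomial (n : ℕ) (P : E → F) : Prop :=
  ∃ T : ContinuousMultilinearMap 𝕜 (fun _ : Fin n => E) F, ∀ x, P x = T (fun _ => x)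

variable (E F)

/-- The continuous `n`-homogeneous polynomials `E → F` that are absolutely `(p; q)`-summing (at the
origin): they map weakly `q`-summable sequences to (strongly) `p`-summable sequences. -/
def summingPolynomials (n : ℕ) (p q : ℝ≥0∞) : Set (E → F) :=
  {P | IsContinuousHomogeneousPolynomial 𝕜 n P ∧
    ∀ x : ℕ → E, WeaklySummableSeq 𝕜 q x → Memℓp (fun j => P (x j)) p}

/-- The continuous `n`-linear maps `E × ⋯ × E → F` that are absolutely `(p; q, …, q)`-summing (at
the origin). -/
def summingMultilinearMaps (n : ℕ) (p q : ℝ≥0∞) :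
    Set (ContinuousMultilinearMap 𝕜 (fun _ : Fin n => E) F) :=
  {T | ∀ x : Fin n → ℕ → E, (∀ s, WeaklySummableSeq 𝕜 q (x s)) →
    Memℓp (fun j => T (fun s => x s j)) p}

end SummingMaps

open MeasureTheory NNReal

/-! ### Separation and representation: from finite inequalities to a dominating measure. -/

section Pietsch

/-! The degree disappears after taking `n`-th roots: `f w = ‖T w‖ ^ (1/n)` is a gauge homogeneous of
degree one, and `(q/n; q)`-summability of `T` (or of a polynomial) is exactly `q`-summability of
`f`. By Pietsch domination, a `q`-summing homogeneous gauge satisfies `f w ^ q ≤ C ∑ i, ∫ |ψ (w i)|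
^ q dμ` for a probability measure `μ` on the weak-star compact dual ball, and for `q ≥ 1` such a
bound conversely gives summability. The theorem thus becomes a comparison of the seminorms that such
measures induce on `X`.

The hypothesis is first reduced to linear operators. There is an `n`-linear `Q` on `l_p` with `‖Q y‖
= ∏ i, ‖y i‖`; testing the hypothesis on `Q ∘ (u, …, u)` shows that every `p`-summing `u : X → l_p`
is `r`-summing.

Maurey's extrapolation argument then applies. For atomic `μ` the canonical map `X → L_p(μ)` lands in
`l_p`, and a gluing argument gives one constant for all atomic measures; convexity extends it to
every probability measure. Hence each `μ` has a `ν` with `‖x‖_{L_p(μ)} ≤ C ‖x‖_{L_r(ν)}`, with `C`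
independent of `μ`. Interpolating `L_r` between `L_1` and `L_p`, iterating `μ ↦ ν` and adding the
measures with geometric weights bounds `‖x‖_{L_p(μ)}` by an `L_1` seminorm. With Pietsch domination
this turns `p`-summing gauges into `1`-summing ones; the reverse inclusion is Jensen's inequality.
-/

theorem exists_positive_functional_dominating {K : Type*} [TopologicalSpace K] [CompactSpace K]
    [Nonempty K] {W : Type*} (g : W → ℝ) (G : W → C(K, ℝ))
    (h : ∀ a : W →₀ ℝ, 0 ≤ a →
      ∃ k, (a.sum fun w t => t * g w) ≤ a.sum fun w t => t * G w k) :
    ∃ Λ : C(K, ℝ) →ₗ[ℝ] ℝ, (∀ f, 0 ≤ f → 0 ≤ Λ f) ∧ Λ 1 = 1 ∧ ∀ w, g w ≤ Λ (G w) := by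
  classical
  let H : W → C(K, ℝ) := fun w => g w • 1 - G w
  let P : Set C(K, ℝ) := {f | ∀ k, 0 < f k}
  let A : Set C(K, ℝ) := (Finsupp.linearCombination ℝ H) '' {a | 0 ≤ a}
  have hPopen : IsOpen P := by
    have := ContinuousMap.isOpen_setOfPred_mapsTo (X := K) (Y := ℝ) isCompact_univ
      (isOpen_Ioi (a := (0 : ℝ)))
    simpa [P, Set.MapsTo] using this
  have hPconv : Convex ℝ P := by
    intro f hf f' hf' s t hs ht hst k
    have h1 := hf k
    have h2 := hf' k
    simp only [ContinuousMap.add_apply, ContinuousMap.smul_apply, smul_eq_mul]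
    rcases hs.eq_or_lt with rfl | hs
    · have : t = 1 := by linarith
      subst this; simpa using h2
    · have := mul_pos hs h1
      have := mul_nonneg ht h2.le
      linarith
  have hAconv : Convex ℝ A := Convex.linear_image (convex_Ici (𝕜 := ℝ) (0 : W →₀ ℝ)) _
  have hdisj : Disjoint P A := by
    rw [Set.disjoint_left]
    rintro _ hP ⟨a, ha, rfl⟩
    obtain ⟨k, hk⟩ := h a ha
    have := hP k
    rw [Finsupp.linearCombination_apply, Finsupp.sum, ContinuousMap.sum_apply] at this
    simp only [Finsupp.sum] at hk
    have h3 : ∑ i ∈ a.support, (a i • H i) k =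
        ∑ i ∈ a.support, a i * g i - ∑ i ∈ a.support, a i * G i k := by
      rw [← Finset.sum_sub_distrib]
      refine Finset.sum_congr rfl fun i _ => ?_
      simp [H, mul_sub]
    linarith
  -- The strictly positive functions form an open cone, disjoint by `h` from the cone generated by
  -- the `g w - G w`. Both being cones, the separating level is `0`; `L` is negative on the first,
  -- so dividing by `L 1` gives the positive normalised functional.
  obtain ⟨L, u, hLP, hLA⟩ := geometric_hahn_banach_open hPconv hPopen hAconv hdisj
  have h1P : (1 : C(K, ℝ)) ∈ P := fun k => by simp
  have hu0 : u ≤ 0 := by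
    simpa using hLA 0 ⟨0, by simp, by simp⟩
  have hL1 : L 1 < 0 := (hLP 1 h1P).trans_le hu0
  have hu : 0 ≤ u := by
    by_contra! hu
    have ht : 0 < u / L 1 := div_pos_of_neg_of_neg hu hL1
    have := hLP ((u / L 1) • 1) (fun k => by simpa using ht)
    rw [map_smul, smul_eq_mul, div_mul_cancel₀ _ hL1.ne] at this
    exact lt_irrefl _ this
  have hpos : ∀ f : C(K, ℝ), 0 ≤ f → L f ≤ 0 := by
    intro f hf
    by_contra! hLf
    have hε : 0 < L f / (-L 1) := div_pos hLf (by linarith)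
    have hm := hLP (f + (L f / (-L 1)) • 1) (fun k => by
      have : 0 ≤ f k := hf k
      simp only [ContinuousMap.add_apply, ContinuousMap.smul_apply, ContinuousMap.one_apply,
        smul_eq_mul, mul_one]
      linarith)
    rw [map_add, map_smul, smul_eq_mul] at hm
    have : L f / (-L 1) * L 1 = - L f := by
      rw [div_neg, neg_mul, div_mul_cancel₀ _ hL1.ne]
    linarith
  refine ⟨(L 1)⁻¹ • (L : C(K, ℝ) →ₗ[ℝ] ℝ), fun f hf => ?_, ?_, fun w => ?_⟩
  · simp only [LinearMap.smul_apply, ContinuousLinearMap.coe_coe, smul_eq_mul]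
    exact mul_nonneg_of_nonpos_of_nonpos (inv_nonpos.2 hL1.le) (hpos f hf)
  · simp [hL1.ne]
  · have := hLA (H w) ⟨Finsupp.single w 1, by simp, by simp⟩
    have h2 : 0 ≤ g w * L 1 - L (G w) := by
      have h3 : L (H w) = g w * L 1 - L (G w) := by simp [H]
      linarith
    simp only [LinearMap.smul_apply, ContinuousLinearMap.coe_coe, smul_eq_mul]
    rw [inv_mul_eq_div, le_div_iff_of_neg hL1]
    linarith

theorem exists_probability_measure_dominating {K : Type*} [TopologicalSpace K] [CompactSpace K]
    [T2Space K] [MeasurableSpace K] [BorelSpace K]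
    [Nonempty K] {W : Type*} (g : W → ℝ) (G : W → C(K, ℝ))
    (h : ∀ a : W →₀ ℝ, 0 ≤ a →
      ∃ k, (a.sum fun w t => t * g w) ≤ a.sum fun w t => t * G w k) :
    ∃ μ : Measure K, IsProbabilityMeasure μ ∧ ∀ w, g w ≤ ∫ k, G w k ∂μ := by
  obtain ⟨Λ, hΛ, hΛ1, hΛg⟩ := exists_positive_functional_dominating g G h
  let Λ' : CompactlySupportedContinuousMap K ℝ →ₚ[ℝ] ℝ := PositiveLinearMap.mk₀
    { toFun := fun f => Λ f.toContinuousMap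
      map_add' := fun f f' => by
        rw [← map_add]; rfl
      map_smul' := fun c f => by
        rw [RingHom.id_apply, ← map_smul]; rfl } (fun f hf => hΛ _ hf)
  have key : ∀ f : C(K, ℝ), ∫ k, f k ∂(RealRMK.rieszMeasure Λ') = Λ f := fun f =>
    RealRMK.integral_rieszMeasure Λ' (CompactlySupportedContinuousMap.continuousMapEquiv f)
  have hreal : (RealRMK.rieszMeasure Λ').real Set.univ = 1 := by
    have := key 1
    simpa [hΛ1] using this
  refine ⟨RealRMK.rieszMeasure Λ', ⟨?_⟩, fun w => (key (G w)).symm ▸ hΛg w⟩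
  rw [measureReal_def] at hreal
  have hfin : RealRMK.rieszMeasure Λ' Set.univ ≠ ∞ := fun h0 => by simp [h0] at hreal
  rw [← ENNReal.ofReal_toReal hfin, hreal, ENNReal.ofReal_one]

end Pietsch

/-! ### The weak-star compact dual ball. -/

section DualBall

/-- The closed unit ball of the dual, with the weak-star topology. -/
def DualBall (𝕜 X : Type*) [RCLike 𝕜] [NormedAddCommGroup X] [NormedSpace 𝕜 X] : Type _ :=
  {φ : WeakDual 𝕜 X // φ ∈ WeakDual.toStrongDual ⁻¹' Metric.closedBall (0 : StrongDual 𝕜 X) 1}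

variable (𝕜 X : Type*) [RCLike 𝕜] [NormedAddCommGroup X] [NormedSpace 𝕜 X]

namespace DualBall

noncomputable instance : TopologicalSpace (DualBall 𝕜 X) := instTopologicalSpaceSubtype
noncomputable instance : T2Space (DualBall 𝕜 X) := inferInstanceAs (T2Space (Subtype _))
noncomputable instance : CompactSpace (DualBall 𝕜 X) :=
  isCompact_iff_compactSpace.1 (WeakDual.isCompact_closedBall (0 : StrongDual 𝕜 X) 1)
noncomputable instance : MeasurableSpace (DualBall 𝕜 X) := borel _
noncomputable instance : BorelSpace (DualBall 𝕜 X) := ⟨rfl⟩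
noncomputable instance : Nonempty (DualBall 𝕜 X) := ⟨⟨0, by simp⟩⟩

variable {𝕜 X}

/-- The functional underlying a point of the dual ball. -/
noncomputable def toDual (φ : DualBall 𝕜 X) : StrongDual 𝕜 X := WeakDual.toStrongDual φ.1

theorem norm_toDual_le (φ : DualBall 𝕜 X) : ‖φ.toDual‖ ≤ 1 := by
  simpa [toDual] using φ.2

theorem exists_toDual_eq (φ : StrongDual 𝕜 X) (h : ‖φ‖ ≤ 1) : ∃ ψ : DualBall 𝕜 X, ψ.toDual = φ :=
  ⟨⟨StrongDual.toWeakDual φ, by simpa using h⟩, by simp [toDual]⟩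

theorem continuous_toDual_apply (x : X) : Continuous fun φ : DualBall 𝕜 X => φ.toDual x :=
  (WeakDual.eval_continuous x).comp continuous_subtype_val

theorem norm_toDual_apply_le (φ : DualBall 𝕜 X) (x : X) : ‖φ.toDual x‖ ≤ ‖x‖ := by
  simpa using φ.toDual.le_of_opNorm_le φ.norm_toDual_le x

theorem enorm_toDual_apply_le (φ : DualBall 𝕜 X) (x : X) : ‖φ.toDual x‖ₑ ≤ ‖x‖ₑ :=
  enorm_le_iff_norm_le.2 (φ.norm_toDual_apply_le x)

theorem continuous_enorm_rpow (x : X) (q : ℝ) :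
    Continuous fun φ : DualBall 𝕜 X => ‖φ.toDual x‖ₑ ^ q :=
  ENNReal.continuous_rpow_const.comp (continuous_toDual_apply x).enorm

theorem measurable_enorm_rpow (x : X) (q : ℝ) :
    Measurable fun φ : DualBall 𝕜 X => ‖φ.toDual x‖ₑ ^ q :=
  (continuous_enorm_rpow x q).measurable

end DualBall

end DualBall

/-! ### Summing gauges and Pietsch domination. -/

section Summing

theorem memℓp_iff_tsum_enorm_rpow_ne_top {E : Type*} [NormedAddCommGroup E] {x : ℕ → E}
    {q : ℝ≥0∞} (hq : 0 < q.toReal) : Memℓp x q ↔ ∑' j, ‖x j‖ₑ ^ q.toReal ≠ ∞ := by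
  rw [memℓp_gen_iff hq]
  have : ∀ j, ‖x j‖ₑ ^ q.toReal = ((‖x j‖₊ ^ q.toReal : ℝ≥0) : ℝ≥0∞) := fun j => by
    rw [ENNReal.coe_rpow_of_nonneg _ hq.le]; rfl
  simp_rw [this]
  rw [ENNReal.tsum_coe_ne_top_iff_summable, ← NNReal.summable_coe]
  simp

/-- Used to glue a sequence of sequences, or of atomic measures, into a single one. -/
theorem ENNReal.tsum_unpair (F : ℕ → ℕ → ℝ≥0∞) :
    ∑' j : ℕ, F j.unpair.1 j.unpair.2 = ∑' k, ∑' l, F k l := by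
  rw [← ENNReal.tsum_prod]
  exact Nat.pairEquiv.symm.tsum_eq (fun z : ℕ × ℕ => F z.1 z.2)

/-- Padding a finite family with zeros lets conditions on sequences be tested on finite sums. -/
theorem exists_seq_tsum_eq_sum {W Z : Type*} [Zero Z] (s : Finset W) (v : W → Z) :
    ∃ x : ℕ → Z, ∀ F : Z → ℝ≥0∞, F 0 = 0 → ∑' j, F (x j) = ∑ w ∈ s, F (v w) := by
  classical
  have : Encodable s := Encodable.ofCountable _
  refine ⟨Function.extend Encodable.encode (fun w : s => v w) 0, fun F hF => ?_⟩
  have h1 : (fun j => F (Function.extend Encodable.encode (fun w : s => v w) 0 j)) =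
      Function.extend Encodable.encode (fun w : s => F (v w)) 0 := by
    funext j
    rw [Function.apply_extend F]
    congr 1
    funext j
    simp [hF]
  rw [h1, tsum_extend_zero Encodable.encode_injective, Finset.tsum_subtype s (fun w => F (v w))]

variable {𝕜 X : Type*} [RCLike 𝕜] [NormedAddCommGroup X] [NormedSpace 𝕜 X]

/-- Weights in a sum of `q`-th powers can thereby be absorbed into the vectors by homogeneity. -/
theorem exists_enorm_rpow_eq (𝕜 : Type*) [RCLike 𝕜] {q : ℝ} (hq : 0 < q) {s : ℝ≥0∞} (hs : s ≠ ∞) :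
    ∃ c : 𝕜, ‖c‖ₑ ^ q = s := by
  lift s to ℝ≥0 using hs
  refine ⟨((s ^ q⁻¹ : ℝ≥0) : ℝ), ?_⟩
  have : ‖(((s ^ q⁻¹ : ℝ≥0) : ℝ) : 𝕜)‖ₑ = ((s ^ q⁻¹ : ℝ≥0) : ℝ≥0∞) := by
    rw [enorm_eq_nnnorm]
    congr 1
    ext
    simp [Real.rpow_nonneg]
  rw [this, ← ENNReal.coe_rpow_of_nonneg _ hq.le, ← NNReal.rpow_mul, inv_mul_cancel₀ hq.ne',
    NNReal.rpow_one]

theorem enorm_smul_rpow {E : Type*} [NormedAddCommGroup E] [NormedSpace 𝕜 E] {q : ℝ} (hq : 0 ≤ q)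
    (c : 𝕜) (x : E) : ‖c • x‖ₑ ^ q = ‖c‖ₑ ^ q * ‖x‖ₑ ^ q := by
  rw [enorm_smul, ENNReal.mul_rpow_of_nonneg _ _ hq]

theorem tsum_enorm_ne_top_of_dualBall {q : ℝ} (hq : 0 < q) {x : ℕ → X}
    (h : ∀ ψ : DualBall 𝕜 X, ∑' j, ‖ψ.toDual (x j)‖ₑ ^ q ≠ ∞) (φ : StrongDual 𝕜 X) :
    ∑' j, ‖φ (x j)‖ₑ ^ q ≠ ∞ := by
  have h0 : (0 : ℝ) < 1 + ‖φ‖ := by positivity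
  let c : 𝕜 := ((1 + ‖φ‖ : ℝ) : 𝕜)
  have hc : ‖c‖ = 1 + ‖φ‖ := by
    simp only [c, RCLike.norm_ofReal, abs_of_pos h0]
  have hc0 : c ≠ 0 := by
    rw [← norm_ne_zero_iff, hc]; exact h0.ne'
  obtain ⟨ψ, hψ⟩ := DualBall.exists_toDual_eq (c⁻¹ • φ) (by
    rw [norm_smul, norm_inv, hc, inv_mul_le_iff₀ h0]; linarith)
  have : ∀ j, ‖φ (x j)‖ₑ ^ q = ‖c‖ₑ ^ q * ‖ψ.toDual (x j)‖ₑ ^ q := fun j => by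
    rw [← enorm_smul_rpow hq.le, hψ]
    simp [hc0]
  simp_rw [this]
  rw [ENNReal.tsum_mul_left]
  exact ENNReal.mul_ne_top (ENNReal.rpow_ne_top_of_nonneg hq.le enorm_ne_top) (h ψ)

theorem weaklySummableSeq_iff {q : ℝ≥0∞} (hq : 0 < q.toReal) {x : ℕ → X} :
    WeaklySummableSeq 𝕜 q x ↔ ∀ ψ : DualBall 𝕜 X, ∑' j, ‖ψ.toDual (x j)‖ₑ ^ q.toReal ≠ ∞ := by
  simp only [WeaklySummableSeq, memℓp_iff_tsum_enorm_rpow_ne_top hq]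
  exact ⟨fun h ψ => h _, fun h φ => tsum_enorm_ne_top_of_dualBall hq h φ⟩

/-- Uniform boundedness, applied on the dual to the truncations `φ ↦ (φ (x j))_{j < N}` with values
in `l_q`. -/
theorem exists_bound_of_weakly_summable {q : ℝ} (hq : 1 ≤ q) {x : ℕ → X}
    (h : ∀ ψ : DualBall 𝕜 X, ∑' j, ‖ψ.toDual (x j)‖ₑ ^ q ≠ ∞) :
    ∃ M : ℝ≥0, ∀ ψ : DualBall 𝕜 X, ∑' j, ‖ψ.toDual (x j)‖ₑ ^ q ≤ M := by
  have hq0 : 0 < q := by linarith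
  have : Fact (1 ≤ ENNReal.ofReal q) := ⟨by simpa using hq⟩
  have hqr : (ENNReal.ofReal q).toReal = q := ENNReal.toReal_ofReal hq0.le
  let T : ℕ → StrongDual 𝕜 X →L[𝕜] lp (fun _ : ℕ => 𝕜) (ENNReal.ofReal q) := fun N =>
    ∑ j ∈ Finset.range N, (lp.singleContinuousLinearMap 𝕜 (fun _ : ℕ => 𝕜) (ENNReal.ofReal q) j).comp
      (ContinuousLinearMap.apply 𝕜 𝕜 (x j))
  have hT : ∀ N φ, ‖T N φ‖ₑ ^ q = ∑ j ∈ Finset.range N, ‖φ (x j)‖ₑ ^ q := by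
    intro N φ
    have h1 : T N φ = ∑ j ∈ Finset.range N, lp.single (ENNReal.ofReal q) j (φ (x j)) := by
      simp only [T, sum_apply]
      rfl
    have h2 : ‖T N φ‖ ^ q = ∑ j ∈ Finset.range N, ‖φ (x j)‖ ^ q := by
      have := lp.norm_sum_single (E := fun _ : ℕ => 𝕜) (p := ENNReal.ofReal q) (by rw [hqr]; exact hq0)
        (fun j => φ (x j)) (Finset.range N)
      rwa [hqr, ← h1] at this
    rw [← ofReal_norm, ENNReal.ofReal_rpow_of_nonneg (norm_nonneg _) hq0.le, h2,
      ENNReal.ofReal_sum_of_nonneg (fun _ _ => by positivity)]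
    refine Finset.sum_congr rfl fun j _ => ?_
    rw [← ofReal_norm, ENNReal.ofReal_rpow_of_nonneg (norm_nonneg _) hq0.le]
  obtain ⟨C, hC⟩ := banach_steinhaus (g := T) (fun φ => by
    refine ⟨((∑' j, ‖φ (x j)‖ₑ ^ q) ^ q⁻¹).toReal, fun N => ?_⟩
    have hfin := tsum_enorm_ne_top_of_dualBall hq0 h φ
    rw [← toReal_enorm]
    refine ENNReal.toReal_mono (ENNReal.rpow_ne_top_of_nonneg (by positivity) hfin) ?_
    rw [ENNReal.le_rpow_inv_iff hq0, hT]
    exact ENNReal.sum_le_tsum _)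
  refine ⟨C.toNNReal ^ q, fun ψ => ?_⟩
  refine ENNReal.tsum_le_of_sum_range_le fun N => ?_
  rw [← hT, ENNReal.coe_rpow_of_nonneg _ hq0.le]
  gcongr
  rw [← ofReal_norm, ← ENNReal.ofReal]
  exact ENNReal.ofReal_le_ofReal (((T N).le_opNorm _).trans
    ((mul_le_of_le_one_right (norm_nonneg _) ψ.norm_toDual_le).trans (hC N)))

/-- A gauge `f` on tuples is `q`-summing if it maps weakly `q`-summable sequences of tuples to
`q`-summable sequences. -/
def IsSummingGauge (𝕜 : Type*) {X ι : Type*} [RCLike 𝕜] [NormedAddCommGroup X] [NormedSpace 𝕜 X]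
    (f : (ι → X) → ℝ≥0∞) (q : ℝ) : Prop :=
  ∀ x : ℕ → ι → X, (∀ (ψ : DualBall 𝕜 X) (i : ι), ∑' j, ‖ψ.toDual (x j i)‖ₑ ^ q ≠ ∞) →
    ∑' j, f (x j) ^ q ≠ ∞

variable {ι : Type*} [Fintype ι] {f : (ι → X) → ℝ≥0∞} {q : ℝ}

/-- If no constant works, pick sequences whose strong sum `S k` exceeds `2 ^ k` times the weak
bound. Rescaled to strong sum `1`, they have weak sums at most `2 ^ (-k)`, so their concatenation is
weakly summable with infinite strong sum. -/
theorem IsSummingGauge.exists_bound (hf : IsSummingGauge 𝕜 f q) (hq : 0 < q)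
    (hom : ∀ (c : 𝕜) w, f (c • w) = ‖c‖ₑ * f w) :
    ∃ C : ℝ≥0, ∀ (x : ℕ → ι → X) (M : ℝ≥0),
      (∀ ψ : DualBall 𝕜 X, ∑' j, ∑ i, ‖ψ.toDual (x j i)‖ₑ ^ q ≤ M) →
      ∑' j, f (x j) ^ q ≤ C * M := by
  by_contra! hcon
  choose x M hM hlt using fun k : ℕ => hcon (2 ^ k)
  have hMi : ∀ k ψ i, ∑' j, ‖DualBall.toDual ψ (x k j i)‖ₑ ^ q ≤ M k := fun k ψ i =>
    (ENNReal.tsum_le_tsum fun j => Finset.single_le_sum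
      (f := fun i => ‖DualBall.toDual ψ (x k j i)‖ₑ ^ q) (fun _ _ => zero_le) (Finset.mem_univ i)).trans
      (hM k ψ)
  set S : ℕ → ℝ≥0∞ := fun k => ∑' j, f (x k j) ^ q with hS
  have hStop : ∀ k, S k ≠ ∞ := fun k =>
    hf (x k) fun ψ i => ne_top_of_le_ne_top ENNReal.coe_ne_top (hMi k ψ i)
  have hS0 : ∀ k, S k ≠ 0 := fun k => (zero_le.trans_lt (hlt k)).ne'
  choose c hc using fun k => exists_enorm_rpow_eq 𝕜 hq (ENNReal.inv_ne_top.2 (hS0 k))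
  refine hf (fun j => c j.unpair.1 • x j.unpair.1 j.unpair.2) (fun ψ i => ?_) ?_
  · rw [ENNReal.tsum_unpair (fun k l => ‖ψ.toDual ((c k • x k l) i)‖ₑ ^ q)]
    refine ne_top_of_le_ne_top (b := ∑' k : ℕ, (2⁻¹ : ℝ≥0∞) ^ k) ?_
      (ENNReal.tsum_le_tsum fun k => ?_)
    · rw [ENNReal.tsum_geometric]; simp
    · simp only [Pi.smul_apply, map_smul, enorm_smul_rpow hq.le, hc]
      rw [ENNReal.tsum_mul_left]
      calc (S k)⁻¹ * ∑' l, ‖ψ.toDual (x k l i)‖ₑ ^ q ≤ (S k)⁻¹ * M k := by gcongr; exact hMi k ψ i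
        _ ≤ (2⁻¹ : ℝ≥0∞) ^ k := by
          rw [mul_comm, ← div_eq_mul_inv]
          refine ENNReal.div_le_of_le_mul ?_
          have h2 : (2⁻¹ : ℝ≥0∞) ^ k * 2 ^ k = 1 := by
            rw [← mul_pow, ENNReal.inv_mul_cancel (by simp) (by simp), one_pow]
          calc (M k : ℝ≥0∞) = 2⁻¹ ^ k * (2 ^ k * M k) := by rw [← mul_assoc, h2, one_mul]
            _ ≤ 2⁻¹ ^ k * S k := by
              gcongr
              simpa using (hlt k).le
  · rw [ENNReal.tsum_unpair (fun k l => f (c k • x k l) ^ q)]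
    simp only [hom, ENNReal.mul_rpow_of_nonneg _ _ hq.le, hc, ENNReal.tsum_mul_left]
    have : ∀ k, (S k)⁻¹ * ∑' i, f (x k i) ^ q = 1 := fun k =>
      ENNReal.inv_mul_cancel (hS0 k) (hStop k)
    simp only [this]
    exact ENNReal.tsum_const_eq_top_of_ne_zero one_ne_zero

/-- **Pietsch domination** for homogeneous gauges. -/
theorem exists_pietsch_measure (hq : 0 < q)
    (hom : ∀ (c : 𝕜) w, f (c • w) = ‖c‖ₑ * f w) (hfin : ∀ w, f w ≠ ∞) {C : ℝ≥0}
    (hC : ∀ (x : ℕ → ι → X) (M : ℝ≥0),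
      (∀ ψ : DualBall 𝕜 X, ∑' j, ∑ i, ‖ψ.toDual (x j i)‖ₑ ^ q ≤ M) →
      ∑' j, f (x j) ^ q ≤ C * M) :
    ∃ μ : Measure (DualBall 𝕜 X), IsProbabilityMeasure μ ∧
      ∀ w, f w ^ q ≤ C * ∑ i, ∫⁻ ψ, ‖ψ.toDual (w i)‖ₑ ^ q ∂μ := by
  let G₀ : (ι → X) → C(DualBall 𝕜 X, ℝ) := fun w =>
    ⟨fun ψ => ∑ i, ‖ψ.toDual (w i)‖ ^ q, continuous_finsetSum _ fun i _ =>
      (DualBall.continuous_toDual_apply (w i)).norm.rpow_const fun _ => Or.inr hq.le⟩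
  have hG₀ : ∀ w ψ, ENNReal.ofReal (G₀ w ψ) = ∑ i, ‖DualBall.toDual ψ (w i)‖ₑ ^ q := fun w ψ => by
    simp only [G₀, ContinuousMap.coe_mk]
    rw [ENNReal.ofReal_sum_of_nonneg (fun _ _ => by positivity)]
    refine Finset.sum_congr rfl fun j _ => ?_
    rw [← ofReal_norm, ENNReal.ofReal_rpow_of_nonneg (norm_nonneg _) hq.le]
  have hG₀nn : ∀ w ψ, 0 ≤ G₀ w ψ := fun w ψ => Finset.sum_nonneg fun _ _ => by positivity
  have hfq : ∀ w, f w ^ q ≠ ∞ := fun w => ENNReal.rpow_ne_top_of_nonneg hq.le (hfin w)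
  obtain ⟨μ, hμ, h⟩ := exists_probability_measure_dominating (fun w => (f w ^ q).toReal)
    (fun w => (C : ℝ) • G₀ w) (by
      intro a ha
      obtain ⟨k, -, hk⟩ := isCompact_univ.exists_isMaxOn (Set.univ_nonempty (α := DualBall 𝕜 X))
        (f := fun ψ => a.sum fun w t => t * G₀ w ψ)
        (by
          refine Continuous.continuousOn ?_
          exact continuous_finsetSum _ fun w _ => continuous_const.mul (G₀ w).continuous)
      refine ⟨k, ?_⟩
      -- Since `‖c w‖ ^ q = a w`, the weighted sums are plain sums along the vectors `c w • w`; `hC`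
      -- applies with `M` the maximum, attained at `k`.
      choose c hc using fun w => exists_enorm_rpow_eq 𝕜 hq (ENNReal.ofReal_ne_top (r := a w))
      obtain ⟨x, hx⟩ := exists_seq_tsum_eq_sum a.support (fun w => c w • w)
      have hnn : ∀ ψ, 0 ≤ a.sum fun w t => t * G₀ w ψ := fun ψ =>
        Finset.sum_nonneg fun w _ => mul_nonneg (ha w) (hG₀nn w ψ)
      have hbound := hC x (a.sum fun w t => t * G₀ w k).toNNReal (fun ψ => by
        rw [hx (fun w => ∑ i, ‖ψ.toDual (w i)‖ₑ ^ q) (by simp [hq])]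
        calc _ = ENNReal.ofReal (a.sum fun w t => t * G₀ w ψ) := by
              rw [Finsupp.sum, ENNReal.ofReal_sum_of_nonneg
                (fun w _ => mul_nonneg (ha w) (hG₀nn w ψ))]
              refine Finset.sum_congr rfl fun w _ => ?_
              simp only [Pi.smul_apply, map_smul, enorm_smul_rpow hq.le, hc]
              rw [ENNReal.ofReal_mul (ha w), hG₀, Finset.mul_sum]
          _ ≤ _ := by
            rw [← ENNReal.ofReal]
            exact ENNReal.ofReal_le_ofReal (hk (Set.mem_univ ψ)))
      rw [hx (fun w => f w ^ q) (by
        have : f 0 = 0 := by simpa using hom 0 0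
        simp [this, hq])] at hbound
      simp only [hom, ENNReal.mul_rpow_of_nonneg _ _ hq.le, hc] at hbound
      have h1 : ENNReal.ofReal (a.sum fun w t => t * (f w ^ q).toReal) ≤
          ENNReal.ofReal (C * a.sum fun w t => t * G₀ w k) := by
        rw [ENNReal.ofReal_mul C.coe_nonneg, ENNReal.ofReal_coe_nnreal]
        refine le_trans (le_of_eq ?_) hbound
        rw [Finsupp.sum, ENNReal.ofReal_sum_of_nonneg
          (fun w _ => mul_nonneg (ha w) ENNReal.toReal_nonneg)]
        refine Finset.sum_congr rfl fun w _ => ?_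
        rw [ENNReal.ofReal_mul (ha w), ENNReal.ofReal_toReal (hfq w)]
      rw [ENNReal.ofReal_le_ofReal_iff (mul_nonneg C.coe_nonneg (hnn k))] at h1
      refine h1.trans (le_of_eq ?_)
      simp only [Finsupp.sum, Finset.mul_sum, ContinuousMap.smul_apply, smul_eq_mul]
      exact Finset.sum_congr rfl fun w _ => by ring)
  refine ⟨μ, hμ, fun w => ?_⟩
  rw [← ENNReal.ofReal_toReal (hfq w)]
  refine (ENNReal.ofReal_le_ofReal (h w)).trans (le_of_eq ?_)
  simp only [ContinuousMap.smul_apply, smul_eq_mul]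
  rw [integral_const_mul, ENNReal.ofReal_mul C.coe_nonneg, ENNReal.ofReal_coe_nnreal,
    ofReal_integral_eq_lintegral_ofReal, ← lintegral_finsetSum]
  · simp only [hG₀]
  · exact fun i _ => DualBall.measurable_enorm_rpow _ _
  · exact (G₀ w).continuous.integrable_of_hasCompactSupport (HasCompactSupport.of_compactSpace _)
  · exact Filter.Eventually.of_forall fun ψ => hG₀nn w ψ

/-- Converse of Pietsch domination: exchange sum and integral, then use that weak sums are uniformly
bounded on the dual ball. -/
theorem isSummingGauge_of_le_lintegral (hq : 1 ≤ q) (μ : Measure (DualBall 𝕜 X))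
    [IsFiniteMeasure μ] (D : ℝ≥0)
    (h : ∀ w, f w ^ q ≤ D * ∑ i, ∫⁻ ψ, ‖ψ.toDual (w i)‖ₑ ^ q ∂μ) : IsSummingGauge 𝕜 f q := by
  intro x hx
  choose M hM using fun i => exists_bound_of_weakly_summable hq (fun ψ => hx ψ i)
  refine ne_top_of_le_ne_top ?_ (ENNReal.tsum_le_tsum fun j => h (x j))
  rw [ENNReal.tsum_mul_left, Summable.tsum_finsetSum fun _ _ => ENNReal.summable]
  refine ENNReal.mul_ne_top ENNReal.coe_ne_top (ENNReal.sum_ne_top.2 fun i _ => ?_)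
  rw [← lintegral_tsum fun j => (DualBall.measurable_enorm_rpow _ _).aemeasurable]
  refine ne_top_of_le_ne_top ?_ (lintegral_mono (hM i))
  rw [lintegral_const]
  exact ENNReal.mul_ne_top ENNReal.coe_ne_top (measure_ne_top μ _)

end Summing

/-! ### Maurey extrapolation for measures on the dual ball. -/

section Extrapolation

theorem lp.enorm_rpow_eq_tsum {E : Type*} [NormedAddCommGroup E] {P : ℝ≥0∞} [Fact (1 ≤ P)]
    (hP : 0 < P.toReal) (y : lp (fun _ : ℕ => E) P) : ‖y‖ₑ ^ P.toReal = ∑' a, ‖y a‖ₑ ^ P.toReal := by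
  rw [← ofReal_norm, ENNReal.ofReal_rpow_of_nonneg (lp.norm_nonneg' _) hP.le,
    lp.norm_rpow_eq_tsum hP, ENNReal.ofReal_tsum_of_nonneg (fun _ => by positivity)
      ((memℓp_gen_iff hP).1 (lp.memℓp y))]
  refine tsum_congr fun a => ?_
  rw [← ofReal_norm, ENNReal.ofReal_rpow_of_nonneg (norm_nonneg _) hP.le]

variable {𝕜 X : Type*} [RCLike 𝕜] [NormedAddCommGroup X] [NormedSpace 𝕜 X]

/-- This is the canonical map into `L_p` of the measure `∑ a, c a • δ_{ψ a}`, realised in `l_p` as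
`x ↦ (d a * ψ a x)` with `‖d a‖ ^ p = c a`. -/
theorem exists_clm_lp_of_atomic {P : ℝ≥0∞} [Fact (1 ≤ P)] (hP : 0 < P.toReal) {c : ℕ → ℝ≥0∞}
    (hc : ∑' a, c a ≠ ∞) (ψ : ℕ → DualBall 𝕜 X) :
    ∃ u : X →L[𝕜] lp (fun _ : ℕ => 𝕜) P, ∀ x,
      ‖u x‖ₑ ^ P.toReal = ∑' a, c a * ‖(ψ a).toDual x‖ₑ ^ P.toReal := by
  choose d hd using fun a => exists_enorm_rpow_eq 𝕜 hP (ENNReal.ne_top_of_tsum_ne_top hc a)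
  have hterm : ∀ x a, ‖d a * (ψ a).toDual x‖ₑ ^ P.toReal =
      c a * ‖(ψ a).toDual x‖ₑ ^ P.toReal := fun x a => by
    rw [← smul_eq_mul, enorm_smul_rpow hP.le, hd]
  have hle : ∀ x, ∑' a, c a * ‖(ψ a).toDual x‖ₑ ^ P.toReal ≤
      (∑' a, c a) * ‖x‖ₑ ^ P.toReal := fun x => by
    rw [← ENNReal.tsum_mul_right]
    gcongr
    exact (ψ _).enorm_toDual_apply_le x
  have hmem : ∀ x, Memℓp (fun a => d a * (ψ a).toDual x) P := fun x => by
    rw [memℓp_iff_tsum_enorm_rpow_ne_top hP]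
    simp_rw [hterm]
    exact ne_top_of_le_ne_top (ENNReal.mul_ne_top hc
      (ENNReal.rpow_ne_top_of_nonneg hP.le enorm_ne_top)) (hle x)
  let u₀ : X →ₗ[𝕜] lp (fun _ : ℕ => 𝕜) P :=
    { toFun := fun x => ⟨fun a => d a * (ψ a).toDual x, hmem x⟩
      map_add' := fun x y => by
        ext a; exact (congrArg _ (map_add _ x y)).trans (mul_add _ _ _)
      map_smul' := fun t x => by
        ext a; simp [mul_left_comm] }
  have hu₀ : ∀ x, ‖u₀ x‖ₑ ^ P.toReal = ∑' a, c a * ‖(ψ a).toDual x‖ₑ ^ P.toReal := fun x => by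
    rw [lp.enorm_rpow_eq_tsum hP]
    exact tsum_congr (hterm x)
  refine ⟨u₀.mkContinuous (((∑' a, c a) ^ P.toReal⁻¹).toReal) fun x => ?_, hu₀⟩
  rw [← toReal_enorm, ← toReal_enorm x, ← ENNReal.toReal_mul]
  refine ENNReal.toReal_mono (ENNReal.mul_ne_top
    (ENNReal.rpow_ne_top_of_nonneg (by positivity) hc) enorm_ne_top) ?_
  rw [← ENNReal.rpow_le_rpow_iff hP, hu₀, ENNReal.mul_rpow_of_nonneg _ _ hP.le,
    ← ENNReal.rpow_mul, inv_mul_cancel₀ hP.ne', ENNReal.rpow_one]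
  exact hle x

/-- If no constant works, superpose the offending atomic measures with weights `2 ^ (-k)`. The
operator of the resulting finite measure is `p`-summing, hence `r`-summing with some constant `C`,
while restricting to the `k`-th measure costs at most a factor `2 ^ k`. The violation by `4 ^ k` is
impossible once `C < 2 ^ k`. -/
theorem exists_bound_atomic {P : ℝ≥0∞} [Fact (1 ≤ P)] {r : ℝ} (hr : 0 < r)
    (hrP : r ≤ P.toReal)
    (hP1 : 1 ≤ P.toReal)
    (hlin : ∀ u : X →L[𝕜] lp (fun _ : ℕ => 𝕜) P,
      IsSummingGauge 𝕜 (fun w : Unit → X => ‖u (w ())‖ₑ) P.toReal →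
      IsSummingGauge 𝕜 (fun w : Unit → X => ‖u (w ())‖ₑ) r) :
    ∃ C : ℝ≥0, ∀ (c : ℕ → ℝ≥0∞) (ψ : ℕ → DualBall 𝕜 X), ∑' a, c a ≤ 1 →
      ∀ (x : ℕ → X) (M : ℝ≥0), (∀ ψ : DualBall 𝕜 X, ∑' j, ‖ψ.toDual (x j)‖ₑ ^ r ≤ M) →
      ∑' j, (∑' a, c a * ‖(ψ a).toDual (x j)‖ₑ ^ P.toReal) ^ (r / P.toReal) ≤ C * M := by
  have hP : 0 < P.toReal := by linarith
  by_contra! hcon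
  choose c ψ hc x M hM hlt using fun k : ℕ => hcon (4 ^ k)
  have hc' : ∑' j : ℕ, (2⁻¹ : ℝ≥0∞) ^ j.unpair.1 * c j.unpair.1 j.unpair.2 ≠ ∞ := by
    rw [ENNReal.tsum_unpair (fun k l => (2⁻¹ : ℝ≥0∞) ^ k * c k l)]
    simp_rw [ENNReal.tsum_mul_left]
    refine ne_top_of_le_ne_top (b := ∑' k : ℕ, (2⁻¹ : ℝ≥0∞) ^ k) ?_
      (ENNReal.tsum_le_tsum fun k => mul_le_of_le_one_right' (hc k))
    rw [ENNReal.tsum_geometric]; simp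
  obtain ⟨u, hu⟩ := exists_clm_lp_of_atomic hP hc' (fun j => ψ j.unpair.1 j.unpair.2)
  have hup : IsSummingGauge 𝕜 (fun w : Unit → X => ‖u (w ())‖ₑ) P.toReal := by
    intro y hy
    obtain ⟨K, hK⟩ := exists_bound_of_weakly_summable hP1 (fun ψ => hy ψ ())
    simp only [hu]
    rw [ENNReal.tsum_comm]
    simp_rw [ENNReal.tsum_mul_left]
    refine ne_top_of_le_ne_top (ENNReal.mul_ne_top hc' (ENNReal.coe_ne_top (r := K))) ?_
    rw [← ENNReal.tsum_mul_right]
    gcongr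
    exact hK _
  obtain ⟨C, hC⟩ := (hlin u hup).exists_bound hr (fun t w => by simp [enorm_smul])
  obtain ⟨k, hk⟩ := pow_unbounded_of_one_lt C (one_lt_two : (1 : ℝ≥0) < 2)
  have h1 := hC (fun j _ => x k j) (M k) (fun ψ => by simpa using hM k ψ)
  set S := ∑' j, (∑' a, c k a * ‖(ψ k a).toDual (x k j)‖ₑ ^ P.toReal) ^ (r / P.toReal) with hS
  have h2 : (2⁻¹ : ℝ≥0∞) ^ k * S ≤ ∑' j, ‖u (x k j)‖ₑ ^ r := by
    rw [hS, ← ENNReal.tsum_mul_left]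
    refine ENNReal.tsum_le_tsum fun j => ?_
    have h3 : ‖u (x k j)‖ₑ ^ r = (‖u (x k j)‖ₑ ^ P.toReal) ^ (r / P.toReal) := by
      rw [← ENNReal.rpow_mul, mul_div_cancel₀ _ hP.ne']
    rw [h3, hu, ENNReal.tsum_unpair (fun k' l => (2⁻¹ : ℝ≥0∞) ^ k' * c k' l *
      ‖(ψ k' l).toDual (x k j)‖ₑ ^ P.toReal)]
    calc _ ≤ ((2⁻¹ : ℝ≥0∞) ^ k) ^ (r / P.toReal) *
          (∑' a, c k a * ‖(ψ k a).toDual (x k j)‖ₑ ^ P.toReal) ^ (r / P.toReal) := by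
          gcongr
          -- As `r / p ≤ 1` and `2 ^ (-k) ≤ 1`, raising the weight to the power `r / p` only
          -- increases it.
          conv_lhs => rw [← ENNReal.rpow_one ((2⁻¹ : ℝ≥0∞) ^ k)]
          exact ENNReal.rpow_le_rpow_of_exponent_ge (pow_le_one' (by simp) k)
            ((div_le_one hP).2 hrP)
      _ ≤ _ := by
          rw [← ENNReal.mul_rpow_of_nonneg _ _ (by positivity), ← ENNReal.tsum_mul_left]
          refine ENNReal.rpow_le_rpow ?_ (by positivity)
          refine le_trans (le_of_eq ?_) (ENNReal.le_tsum (f := fun k' => ∑' l, (2⁻¹ : ℝ≥0∞) ^ k' * c k' l *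
            ‖(ψ k' l).toDual (x k j)‖ₑ ^ P.toReal) k)
          simp only [mul_assoc]
  have h4 : S ≤ 2 ^ k * (C * M k) := by
    calc S = 2 ^ k * ((2⁻¹ : ℝ≥0∞) ^ k * S) := by
          rw [← mul_assoc, ← mul_pow, ENNReal.mul_inv_cancel (by simp) (by simp), one_pow, one_mul]
      _ ≤ _ := mul_le_mul_right (h2.trans h1) _
  have h5 := (hlt k).trans_le h4
  have h6 : 4 ^ k * M k < 2 ^ k * (C * M k) := by exact_mod_cast h5
  have h7 : 2 ^ k * (C * M k) ≤ 4 ^ k * M k := by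
    calc 2 ^ k * (C * M k) ≤ 2 ^ k * (2 ^ k * M k) := by gcongr
      _ = 4 ^ k * M k := by rw [← mul_assoc, ← mul_pow]; norm_num
  exact absurd h6 (not_lt.2 h7)

/-- For finitely many `x j`, the moment vector of `μ` lies in the closed convex hull of the moment
vectors of point masses. Atomic measures give a convex set containing these, and the desired
inequality is a closed condition. -/
theorem tsum_lintegral_rpow_le_of_atomic {p r : ℝ} (hp : 0 < p) (hr : 0 < r) {C M : ℝ≥0}
    {x : ℕ → X} (h : ∀ (c : ℕ → ℝ≥0∞) (ψ : ℕ → DualBall 𝕜 X), ∑' a, c a ≤ 1 →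
      ∑' j, (∑' a, c a * ‖(ψ a).toDual (x j)‖ₑ ^ p) ^ (r / p) ≤ C * M)
    (μ : Measure (DualBall 𝕜 X)) [IsProbabilityMeasure μ] :
    ∑' j, (∫⁻ ψ, ‖ψ.toDual (x j)‖ₑ ^ p ∂μ) ^ (r / p) ≤ C * M := by
  refine ENNReal.tsum_le_of_sum_range_le fun N => ?_
  rw [← Fin.sum_univ_eq_sum_range (fun j => (∫⁻ ψ, ‖ψ.toDual (x j)‖ₑ ^ p ∂μ) ^ (r / p))]
  -- Taking minorants of moment vectors, rather than the vectors themselves, lets convexity follow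
  -- from subadditivity of `ENNReal.ofReal`.
  let V : Set (Fin N → ℝ) := {v | ∃ (c : ℕ → ℝ≥0∞) (ψ : ℕ → DualBall 𝕜 X), ∑' a, c a ≤ 1 ∧
    ∀ j, ENNReal.ofReal (v j) ≤ ∑' a, c a * ‖(ψ a).toDual (x j)‖ₑ ^ p}
  let S : Set (Fin N → ℝ) := {v | ∑ j, ENNReal.ofReal (v j) ^ (r / p) ≤ C * M}
  have hSclosed : IsClosed S := by
    refine isClosed_le (continuous_finsetSum _ fun j _ => ?_) continuous_const
    exact ENNReal.continuous_rpow_const.comp (ENNReal.continuous_ofReal.comp (continuous_apply j))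
  have hVS : V ⊆ S := by
    rintro v ⟨c, ψ, hc, hv⟩
    calc ∑ j, ENNReal.ofReal (v j) ^ (r / p)
        ≤ ∑ j : Fin N, (∑' a, c a * ‖(ψ a).toDual (x j)‖ₑ ^ p) ^ (r / p) := by
          gcongr with j; exact hv j
      _ = ∑ j ∈ Finset.range N, (∑' a, c a * ‖(ψ a).toDual (x j)‖ₑ ^ p) ^ (r / p) :=
          Fin.sum_univ_eq_sum_range
            (fun j => (∑' a, c a * ‖(ψ a).toDual (x j)‖ₑ ^ p) ^ (r / p)) N
      _ ≤ _ := ENNReal.sum_le_tsum _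
      _ ≤ _ := h c ψ hc
  have hVconv : Convex ℝ V := by
    rintro v ⟨c, ψ, hc, hv⟩ v' ⟨c', ψ', hc', hv'⟩ s t hs ht hst
    let W : ℕ → ℝ≥0∞ := fun k =>
      if k = 0 then ENNReal.ofReal s else if k = 1 then ENNReal.ofReal t else 0
    have hW : ∀ F : ℕ → ℝ≥0∞, ∑' k, W k * F k =
        ENNReal.ofReal s * F 0 + ENNReal.ofReal t * F 1 := fun F => by
      rw [tsum_eq_sum (s := Finset.range 2), Finset.sum_range_succ, Finset.sum_range_one]
      · simp [W]
      · intro k hk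
        simp only [Finset.mem_range, not_lt] at hk
        have h0 : k ≠ 0 := by omega
        have h1 : k ≠ 1 := by omega
        simp [W, h0, h1]
    refine ⟨fun j => W j.unpair.1 * (if j.unpair.1 = 0 then c else c') j.unpair.2,
      fun j => (if j.unpair.1 = 0 then ψ else ψ') j.unpair.2, ?_, fun i => ?_⟩
    · rw [ENNReal.tsum_unpair (fun k l => W k * (if k = 0 then c else c') l)]
      simp_rw [ENNReal.tsum_mul_left]
      rw [hW (fun k => ∑' l, (if k = 0 then c else c') l)]
      calc _ ≤ ENNReal.ofReal s * 1 + ENNReal.ofReal t * 1 := by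
            gcongr
            · simpa using hc
            · simpa using hc'
        _ = 1 := by rw [mul_one, mul_one, ← ENNReal.ofReal_add hs ht, hst, ENNReal.ofReal_one]
    · rw [ENNReal.tsum_unpair (fun k l => W k * (if k = 0 then c else c') l *
        ‖((if k = 0 then ψ else ψ') l).toDual (x i)‖ₑ ^ p)]
      simp_rw [mul_assoc, ENNReal.tsum_mul_left]
      rw [hW (fun k => ∑' l, (if k = 0 then c else c') l *
        ‖((if k = 0 then ψ else ψ') l).toDual (x i)‖ₑ ^ p)]
      simp only [Pi.add_apply, Pi.smul_apply, smul_eq_mul]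
      refine ENNReal.ofReal_add_le.trans ?_
      rw [ENNReal.ofReal_mul hs, ENNReal.ofReal_mul ht]
      gcongr
      · simpa using hv i
      · simpa using hv' i
  let F : DualBall 𝕜 X → Fin N → ℝ := fun ψ j => ‖ψ.toDual (x j)‖ ^ p
  have hFj : ∀ j : Fin N, Continuous fun ψ => F ψ j := fun j =>
    (DualBall.continuous_toDual_apply (x j)).norm.rpow_const fun _ => Or.inr hp.le
  have hF : Continuous F := continuous_pi hFj
  have hFV : ∀ ψ, F ψ ∈ V := fun ψ => by
    refine ⟨fun a => if a = 0 then 1 else 0, fun _ => ψ, by simp, fun j => ?_⟩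
    simp only [ite_mul, one_mul, zero_mul, tsum_ite_eq, F]
    rw [← ofReal_norm, ENNReal.ofReal_rpow_of_nonneg (norm_nonneg _) hp.le]
  have hint : Integrable F μ := hF.integrable_of_hasCompactSupport (.of_compactSpace _)
  have hmem : ∫ ψ, F ψ ∂μ ∈ S :=
    closure_minimal hVS hSclosed (hVconv.closure.integral_mem isClosed_closure
      (.of_forall fun ψ => subset_closure (hFV ψ)) hint)
  refine le_trans (le_of_eq ?_) hmem
  refine Finset.sum_congr rfl fun j _ => ?_
  rw [eval_integral (fun j => (hFj j).integrable_of_hasCompactSupport (.of_compactSpace _)),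
    ofReal_integral_eq_lintegral_ofReal
      ((hFj j).integrable_of_hasCompactSupport (.of_compactSpace _))
      (.of_forall fun ψ => by simp only [F]; positivity)]
  congr 1
  refine lintegral_congr fun ψ => ?_
  rw [← ofReal_norm, ENNReal.ofReal_rpow_of_nonneg (norm_nonneg _) hp.le]

/-- Pietsch domination for the gauge `x ↦ ‖x‖_{L_p(μ)}`. That `C` precedes `μ` is what makes
iteration possible. -/
theorem exists_dominating_probabilityMeasure {P : ℝ≥0∞} [Fact (1 ≤ P)] {r : ℝ} (hr : 0 < r)
    (hrP : r ≤ P.toReal)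
    (hP1 : 1 ≤ P.toReal)
    (hlin : ∀ u : X →L[𝕜] lp (fun _ : ℕ => 𝕜) P,
      IsSummingGauge 𝕜 (fun w : Unit → X => ‖u (w ())‖ₑ) P.toReal →
      IsSummingGauge 𝕜 (fun w : Unit → X => ‖u (w ())‖ₑ) r) :
    ∃ C : ℝ≥0, ∀ μ : ProbabilityMeasure (DualBall 𝕜 X), ∃ ν : ProbabilityMeasure (DualBall 𝕜 X),
      ∀ x, (∫⁻ ψ : DualBall 𝕜 X, ‖ψ.toDual x‖ₑ ^ P.toReal ∂μ) ^ (r / P.toReal) ≤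
        C * ∫⁻ ψ : DualBall 𝕜 X, ‖ψ.toDual x‖ₑ ^ r ∂ν := by
  have hP : 0 < P.toReal := by linarith
  obtain ⟨C, hC⟩ := exists_bound_atomic hr hrP hP1 hlin
  refine ⟨C, fun μ => ?_⟩
  have hpow : ∀ I : ℝ≥0∞, (I ^ P.toReal⁻¹) ^ r = I ^ (r / P.toReal) := fun I => by
    rw [← ENNReal.rpow_mul, inv_mul_eq_div]
  obtain ⟨ν, hν, h⟩ := exists_pietsch_measure (𝕜 := 𝕜) (X := X) (ι := Unit) (q := r) (C := C)
    (f := fun w => (∫⁻ ψ : DualBall 𝕜 X, ‖ψ.toDual (w ())‖ₑ ^ P.toReal ∂μ) ^ P.toReal⁻¹) hr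
    (fun c w => by
      simp only [Pi.smul_apply, map_smul, enorm_smul_rpow hP.le]
      rw [lintegral_const_mul _ (DualBall.measurable_enorm_rpow _ _),
        ENNReal.mul_rpow_of_nonneg _ _ (by positivity), ← ENNReal.rpow_mul,
        mul_inv_cancel₀ hP.ne', ENNReal.rpow_one])
    (fun w => by
      refine ENNReal.rpow_ne_top_of_nonneg (by positivity) ?_
      refine ne_top_of_le_ne_top (b := ‖w ()‖ₑ ^ P.toReal)
        (ENNReal.rpow_ne_top_of_nonneg hP.le enorm_ne_top) ?_
      refine (lintegral_mono (g := fun _ => ‖w ()‖ₑ ^ P.toReal) fun ψ => ?_).trans (by simp)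
      dsimp only
      gcongr
      exact ψ.enorm_toDual_apply_le _)
    (fun x M hM => by
      simp only [hpow]
      refine tsum_lintegral_rpow_le_of_atomic (𝕜 := 𝕜) hP hr (x := fun j => x j ()) (fun c ψ hc => ?_) μ
      exact hC c ψ hc _ M (fun ψ => by simpa using hM ψ))
  exact ⟨⟨ν, hν⟩, fun x => by simpa [hpow] using h (fun _ => x)⟩

/-- **Maurey extrapolation**, in terms of measures on the dual ball. -/
theorem exists_finite_measure_extrapolation {p r : ℝ} (hr : 1 < r) (hrp : r < p) {C : ℝ≥0}
    (h : ∀ μ : ProbabilityMeasure (DualBall 𝕜 X), ∃ ν : ProbabilityMeasure (DualBall 𝕜 X),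
      ∀ x, (∫⁻ ψ : DualBall 𝕜 X, ‖ψ.toDual x‖ₑ ^ p ∂μ) ^ (r / p) ≤ C * ∫⁻ ψ : DualBall 𝕜 X, ‖ψ.toDual x‖ₑ ^ r ∂ν)
    (μ : ProbabilityMeasure (DualBall 𝕜 X)) :
    ∃ (D : ℝ≥0) (ν : Measure (DualBall 𝕜 X)), IsFiniteMeasure ν ∧
      ∀ x, (∫⁻ ψ : DualBall 𝕜 X, ‖ψ.toDual x‖ₑ ^ p ∂μ) ^ p⁻¹ ≤ D * ∫⁻ ψ : DualBall 𝕜 X, ‖ψ.toDual x‖ₑ ∂ν := by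
  have hp : 0 < p := by linarith
  have hr0 : 0 < r := by linarith
  have hp1 : 0 < p - 1 := by linarith
  -- Hölder weights for `L_r` between `L_1` and `L_p`: `a + b = 1` and `a + p * b = r`.
  set a : ℝ := (p - r) / (p - 1) with ha
  set b : ℝ := (r - 1) / (p - 1) with hb
  have ha0 : 0 < a := div_pos (by linarith) hp1
  have hb0 : 0 < b := div_pos (by linarith) hp1
  have hab : a + b = 1 := by rw [ha, hb]; field_simp; ring
  have habr : a + p * b = r := by rw [ha, hb]; field_simp; ring
  set θ : ℝ := a / r with hθ
  have hθ0 : 0 < θ := div_pos ha0 hr0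
  have hθ1 : θ + p * b / r = 1 := by rw [hθ, ← add_div, habr, div_self hr0.ne']
  have hη0 : 0 < p * b / r := by positivity
  let N : ProbabilityMeasure (DualBall 𝕜 X) → X → ℝ≥0∞ := fun μ x =>
    (∫⁻ ψ : DualBall 𝕜 X, ‖ψ.toDual x‖ₑ ^ p ∂μ) ^ p⁻¹
  let O : ProbabilityMeasure (DualBall 𝕜 X) → X → ℝ≥0∞ := fun μ x =>
    ∫⁻ ψ : DualBall 𝕜 X, ‖ψ.toDual x‖ₑ ∂μ
  -- Chosen so that `K ^ θ * 4⁻¹ ^ (p * b / r) = C ^ r⁻¹`, which leaves the `L_p` term with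
  -- coefficient `4⁻¹` and so makes the iteration contract.
  let K : ℝ≥0 := (C ^ r⁻¹ * 4 ^ (p * b / r)) ^ θ⁻¹
  have hint : ∀ (ν : ProbabilityMeasure (DualBall 𝕜 X)) x,
      ∫⁻ ψ : DualBall 𝕜 X, ‖ψ.toDual x‖ₑ ^ r ∂ν ≤ O ν x ^ a * (N ν x ^ p) ^ b := fun ν x => by
    have h1 : ∀ ψ : DualBall 𝕜 X, ‖ψ.toDual x‖ₑ ^ r =
        ‖ψ.toDual x‖ₑ ^ a * (‖ψ.toDual x‖ₑ ^ p) ^ b := fun ψ => by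
      rw [← ENNReal.rpow_mul, ← ENNReal.rpow_add_of_nonneg _ _ ha0.le (by positivity), habr]
    simp_rw [h1]
    have h2 : N ν x ^ p = ∫⁻ ψ : DualBall 𝕜 X, ‖ψ.toDual x‖ₑ ^ p ∂ν := by
      simp only [N]
      rw [← ENNReal.rpow_mul, inv_mul_cancel₀ hp.ne', ENNReal.rpow_one]
    rw [h2]
    exact ENNReal.lintegral_mul_norm_pow_le
      (by simpa using (DualBall.measurable_enorm_rpow x 1).aemeasurable)
      (DualBall.measurable_enorm_rpow x p).aemeasurable ha0.le hb0.le hab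
  choose ν hν using h
  have hstep : ∀ μ x, N μ x ≤ K * O (ν μ) x + 4⁻¹ * N (ν μ) x := fun μ x => by
    set T := K * O (ν μ) x + 4⁻¹ * N (ν μ) x with hT
    have h1 : N μ x ^ r ≤ C * (O (ν μ) x ^ a * (N (ν μ) x ^ p) ^ b) := by
      have : N μ x ^ r = (∫⁻ ψ : DualBall 𝕜 X, ‖ψ.toDual x‖ₑ ^ p ∂μ) ^ (r / p) := by
        simp only [N]
        rw [← ENNReal.rpow_mul, inv_mul_eq_div]
      rw [this]
      exact (hν μ x).trans (by gcongr; exact hint _ x)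
    have h2 : N μ x ≤ C ^ r⁻¹ * (O (ν μ) x ^ θ * N (ν μ) x ^ (p * b / r)) := by
      have h3 := ENNReal.rpow_le_rpow h1 (inv_nonneg.2 hr0.le)
      rw [← ENNReal.rpow_mul, mul_inv_cancel₀ hr0.ne', ENNReal.rpow_one,
        ENNReal.mul_rpow_of_nonneg _ _ (inv_nonneg.2 hr0.le),
        ENNReal.mul_rpow_of_nonneg _ _ (inv_nonneg.2 hr0.le), ← ENNReal.rpow_mul,
        ← ENNReal.rpow_mul, ← ENNReal.rpow_mul, ← div_eq_mul_inv, ← div_eq_mul_inv] at h3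
      rwa [mul_div_assoc]
    have h4 : (K * O (ν μ) x) ^ θ * (4⁻¹ * N (ν μ) x) ^ (p * b / r) =
        C ^ r⁻¹ * (O (ν μ) x ^ θ * N (ν μ) x ^ (p * b / r)) := by
      have hK : (K : ℝ≥0∞) ^ θ = C ^ r⁻¹ * 4 ^ (p * b / r) := by
        simp only [K]
        rw [← ENNReal.coe_rpow_of_nonneg _ hθ0.le, ← NNReal.rpow_mul, inv_mul_cancel₀ hθ0.ne',
          NNReal.rpow_one, ENNReal.coe_mul, ENNReal.coe_rpow_of_nonneg _ (inv_nonneg.2 hr0.le),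
          ENNReal.coe_rpow_of_nonneg _ hη0.le]
        rfl
      have h44 : (4 : ℝ≥0∞) ^ (p * b / r) * (4⁻¹) ^ (p * b / r) = 1 := by
        rw [← ENNReal.mul_rpow_of_nonneg _ _ hη0.le, ENNReal.mul_inv_cancel (by simp) (by simp),
          ENNReal.one_rpow]
      rw [ENNReal.mul_rpow_of_nonneg _ _ hθ0.le, ENNReal.mul_rpow_of_nonneg _ _ hη0.le, hK]
      calc _ = (C : ℝ≥0∞) ^ r⁻¹ * (O (ν μ) x ^ θ * N (ν μ) x ^ (p * b / r)) *
            ((4 : ℝ≥0∞) ^ (p * b / r) * (4⁻¹) ^ (p * b / r)) := by ring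
        _ = _ := by rw [h44, mul_one]
    calc N μ x ≤ (K * O (ν μ) x) ^ θ * (4⁻¹ * N (ν μ) x) ^ (p * b / r) := h2.trans_eq h4.symm
      -- A crude Young inequality: each factor is at most the sum `T`, and the exponents add up to
      -- `1`.
      _ ≤ T ^ θ * T ^ (p * b / r) := by
        gcongr
        · exact le_self_add
        · exact le_add_self
      _ = T := by
        rw [← ENNReal.rpow_add_of_nonneg _ _ hθ0.le hη0.le, hθ1, ENNReal.rpow_one]
  have hNle : ∀ μ x, N μ x ≤ ‖x‖ₑ := fun μ x => by
    simp only [N]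
    rw [ENNReal.rpow_inv_le_iff hp]
    refine (lintegral_mono (g := fun _ => ‖x‖ₑ ^ p) fun ψ => ?_).trans (by simp)
    dsimp only
    gcongr
    exact ψ.enorm_toDual_apply_le _
  let m : ℕ → ProbabilityMeasure (DualBall 𝕜 X) := fun k => ν^[k] μ
  have hiter : ∀ (x : X) (k : ℕ), N μ x ≤
      K * ∑ i ∈ Finset.range k, 4⁻¹ ^ i * O (m (i + 1)) x + 4⁻¹ ^ k * N (m k) x := fun x k => by
    induction k with
    | zero => simp [m]
    | succ k ih =>
      refine ih.trans ?_
      have h1 := hstep (m k) x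
      rw [show ν (m k) = m (k + 1) from (Function.iterate_succ_apply' ν k μ).symm] at h1
      rw [Finset.sum_range_succ]
      calc _ ≤ K * ∑ i ∈ Finset.range k, 4⁻¹ ^ i * O (m (i + 1)) x +
            4⁻¹ ^ k * (K * O (m (k + 1)) x + 4⁻¹ * N (m (k + 1)) x) := by gcongr
        _ = _ := by ring
  -- The geometric weights come from the iteration; its remainder `4⁻¹ ^ k * N (m k) x` vanishes
  -- because `N` is bounded by `‖x‖`.
  refine ⟨K, Measure.sum fun k => ((4⁻¹ : ℝ≥0∞) ^ k) • (m (k + 1) : Measure (DualBall 𝕜 X)),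
    ⟨?_⟩, fun x => ?_⟩
  · rw [Measure.sum_apply _ .univ]
    simp only [Measure.smul_apply, smul_eq_mul, measure_univ, mul_one]
    rw [ENNReal.tsum_geometric, lt_top_iff_ne_top, ENNReal.inv_ne_top]
    exact (tsub_pos_of_lt (ENNReal.inv_lt_one.2 (by norm_num))).ne'
  · rw [lintegral_sum_measure]
    simp only [lintegral_smul_measure, smul_eq_mul]
    have hlim : Filter.Tendsto (fun k : ℕ => K * (∑' i : ℕ, 4⁻¹ ^ i * O (m (i + 1)) x) +
        4⁻¹ ^ k * ‖x‖ₑ) Filter.atTop (nhds (K * (∑' i : ℕ, 4⁻¹ ^ i * O (m (i + 1)) x) +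
          0 * ‖x‖ₑ)) :=
      tendsto_const_nhds.add (ENNReal.Tendsto.mul_const
        (ENNReal.tendsto_pow_atTop_nhds_zero_of_lt_one (ENNReal.inv_lt_one.2 (by norm_num)))
        (Or.inr enorm_ne_top))
    rw [zero_mul, add_zero] at hlim
    refine ge_of_tendsto' hlim fun k => (hiter x k).trans ?_
    gcongr
    · exact ENNReal.sum_le_tsum _
    · exact hNle _ _

end Extrapolation

/-! ### Comparing `p`-summing and `1`-summing gauges. -/

section Gauges

variable {𝕜 X : Type*} [RCLike 𝕜] [NormedAddCommGroup X] [NormedSpace 𝕜 X]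
  {ι : Type*} [Fintype ι] {f : (ι → X) → ℝ≥0∞}

/-- Jensen's inequality for the Pietsch probability measure raises the exponent; the power of
`Fintype.card ι` comes from the power-mean inequality for the sum over coordinates. -/
theorem IsSummingGauge.of_one {q : ℝ} (hf : IsSummingGauge 𝕜 f 1) (hq : 1 ≤ q)
    (hom : ∀ (c : 𝕜) w, f (c • w) = ‖c‖ₑ * f w) (hfin : ∀ w, f w ≠ ∞) :
    IsSummingGauge 𝕜 f q := by
  have hq0 : 0 < q := by linarith
  obtain ⟨C, hC⟩ := hf.exists_bound one_pos hom
  obtain ⟨μ, hμ, h⟩ := exists_pietsch_measure one_pos hom hfin hC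
  refine isSummingGauge_of_le_lintegral hq μ
    (C ^ q * (Fintype.card ι : ℝ≥0) ^ (q - 1)) fun w => ?_
  have h1 := h w
  simp only [ENNReal.rpow_one] at h1
  have hjensen : ∀ x : X, (∫⁻ ψ : DualBall 𝕜 X, ‖ψ.toDual x‖ₑ ∂μ) ^ q ≤
      ∫⁻ ψ : DualBall 𝕜 X, ‖ψ.toDual x‖ₑ ^ q ∂μ := fun x => by
    have := eLpNorm'_le_eLpNorm'_of_exponent_le one_pos hq μ
      (DualBall.continuous_toDual_apply (𝕜 := 𝕜) x).measurable.aestronglyMeasurable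
    simp only [eLpNorm', ENNReal.rpow_one, div_one, one_div] at this
    rwa [ENNReal.le_rpow_inv_iff hq0] at this
  calc f w ^ q ≤ (C * ∑ i, ∫⁻ ψ : DualBall 𝕜 X, ‖ψ.toDual (w i)‖ₑ ∂μ) ^ q := by gcongr
    _ = C ^ q * (∑ i, ∫⁻ ψ : DualBall 𝕜 X, ‖ψ.toDual (w i)‖ₑ ∂μ) ^ q :=
      ENNReal.mul_rpow_of_nonneg _ _ hq0.le
    _ ≤ C ^ q * ((Fintype.card ι : ℝ≥0∞) ^ (q - 1) *
        ∑ i, (∫⁻ ψ : DualBall 𝕜 X, ‖ψ.toDual (w i)‖ₑ ∂μ) ^ q) := by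
      gcongr
      exact ENNReal.rpow_sum_le_const_mul_sum_rpow _ _ hq
    _ ≤ C ^ q * ((Fintype.card ι : ℝ≥0∞) ^ (q - 1) *
        ∑ i, ∫⁻ ψ : DualBall 𝕜 X, ‖ψ.toDual (w i)‖ₑ ^ q ∂μ) := by
      gcongr; exact hjensen _
    _ = _ := by
      rw [ENNReal.coe_mul, ENNReal.coe_rpow_of_nonneg _ hq0.le,
        ENNReal.coe_rpow_of_nonneg _ (sub_nonneg.2 hq), ENNReal.coe_natCast, mul_assoc]

theorem IsSummingGauge.one_of_extrapolation {p : ℝ} (hp : 0 < p) (hf : IsSummingGauge 𝕜 f p)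
    (hom : ∀ (c : 𝕜) w, f (c • w) = ‖c‖ₑ * f w) (hfin : ∀ w, f w ≠ ∞)
    (hext : ∀ μ : ProbabilityMeasure (DualBall 𝕜 X),
      ∃ (D : ℝ≥0) (ν : Measure (DualBall 𝕜 X)), IsFiniteMeasure ν ∧
        ∀ x, (∫⁻ ψ : DualBall 𝕜 X, ‖ψ.toDual x‖ₑ ^ p ∂μ) ^ p⁻¹ ≤
          D * ∫⁻ ψ : DualBall 𝕜 X, ‖ψ.toDual x‖ₑ ∂ν) :
    IsSummingGauge 𝕜 f 1 := by
  obtain ⟨C, hC⟩ := hf.exists_bound hp hom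
  obtain ⟨μ, hμ, h⟩ := exists_pietsch_measure hp hom hfin hC
  obtain ⟨D, ν, hν, hD⟩ := hext ⟨μ, hμ⟩
  refine isSummingGauge_of_le_lintegral le_rfl ν
    ((C * Fintype.card ι) ^ p⁻¹ * D) fun w => ?_
  simp only [ENNReal.rpow_one]
  set S := ∑ i, ∫⁻ ψ : DualBall 𝕜 X, ‖ψ.toDual (w i)‖ₑ ∂ν with hS
  have h1 : f w ^ p ≤ C * Fintype.card ι * (D * S) ^ p := by
    refine (h w).trans ?_
    rw [mul_assoc]
    gcongr
    rw [← nsmul_eq_mul, ← Finset.card_univ]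
    refine Finset.sum_le_card_nsmul _ _ _ fun i _ => ?_
    rw [← ENNReal.rpow_inv_le_iff hp]
    refine (hD (w i)).trans ?_
    gcongr
    exact Finset.single_le_sum (f := fun i => ∫⁻ ψ : DualBall 𝕜 X, ‖ψ.toDual (w i)‖ₑ ∂ν)
      (fun _ _ => zero_le) (Finset.mem_univ i)
  rw [← ENNReal.rpow_le_rpow_iff hp]
  refine h1.trans (le_of_eq ?_)
  rw [ENNReal.coe_mul, mul_assoc _ (D : ℝ≥0∞), ENNReal.mul_rpow_of_nonneg _ (D * S) hp.le,
    ENNReal.coe_rpow_of_nonneg _ (inv_nonneg.2 hp.le), ← ENNReal.rpow_mul,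
    inv_mul_cancel₀ hp.ne', ENNReal.rpow_one]
  simp

/-- The extrapolation theorem for homogeneous gauges. -/
theorem isSummingGauge_iff_one {P : ℝ≥0∞} [Fact (1 ≤ P)] {r : ℝ} (hr : 1 < r) (hrP : r < P.toReal)
    (hlin : ∀ u : X →L[𝕜] lp (fun _ : ℕ => 𝕜) P,
      IsSummingGauge 𝕜 (fun w : Unit → X => ‖u (w ())‖ₑ) P.toReal →
      IsSummingGauge 𝕜 (fun w : Unit → X => ‖u (w ())‖ₑ) r)
    (hom : ∀ (c : 𝕜) w, f (c • w) = ‖c‖ₑ * f w) (hfin : ∀ w, f w ≠ ∞) :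
    IsSummingGauge 𝕜 f P.toReal ↔ IsSummingGauge 𝕜 f 1 := by
  refine ⟨fun hf => ?_, fun hf => hf.of_one (by linarith) hom hfin⟩
  obtain ⟨C, hC⟩ := exists_dominating_probabilityMeasure (by linarith) hrP.le (by linarith) hlin
  exact hf.one_of_extrapolation (by linarith) hom hfin
    (exists_finite_measure_extrapolation hr hrP hC)

end Gauges

/-! ### A norm-multiplicative `n`-linear map on `l_p`. -/

section TensorPower

theorem ENNReal.tsum_pi_prod (n : ℕ) (g : Fin n → ℕ → ℝ≥0∞) :
    ∑' a : Fin n → ℕ, ∏ i, g i (a i) = ∏ i, ∑' k, g i k := by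
  induction n with
  | zero => simp
  | succ n ih =>
    rw [← (Fin.consEquiv fun _ : Fin (n + 1) => ℕ).tsum_eq, ENNReal.tsum_prod', Fin.prod_univ_succ,
      ← ih (fun i => g i.succ), ← ENNReal.tsum_mul_right]
    refine tsum_congr fun k => ?_
    rw [← ENNReal.tsum_mul_left]
    refine tsum_congr fun a => ?_
    rw [Fin.prod_univ_succ]
    simp [Fin.consEquiv]

/-- The tensor `(y 1, …, y n) ↦ (∏ i, y i (a i))_a` lies in `l_p(ℕ^n)`, its norm factors, and `ℕ^n`
is re-indexed by `ℕ`. -/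
theorem exists_multilinear_lp_enorm_eq_prod (𝕜 : Type*) [RCLike 𝕜] {n : ℕ} (hn : 1 ≤ n) {P : ℝ≥0∞}
    [Fact (1 ≤ P)] (hP : 0 < P.toReal) :
    ∃ Q : ContinuousMultilinearMap 𝕜 (fun _ : Fin n => lp (fun _ : ℕ => 𝕜) P)
      (lp (fun _ : ℕ => 𝕜) P), ∀ y, ‖Q y‖ₑ = ∏ i, ‖y i‖ₑ := by
  -- Needed for `Fin n → ℕ` to be infinite, hence in bijection with `ℕ`.
  have : Nonempty (Fin n) := ⟨⟨0, hn⟩⟩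
  obtain ⟨e⟩ : Nonempty (ℕ ≃ (Fin n → ℕ)) := nonempty_equiv_of_countable
  have hsum : ∀ y : Fin n → lp (fun _ : ℕ => 𝕜) P,
      ∑' a, ‖∏ i, y i (e a i)‖ₑ ^ P.toReal = ∏ i, ‖y i‖ₑ ^ P.toReal := fun y => by
    have h1 : ∀ a, ‖∏ i, y i (e a i)‖ₑ ^ P.toReal = ∏ i, ‖y i (e a i)‖ₑ ^ P.toReal := fun a => by
      rw [ENNReal.prod_rpow_of_nonneg hP.le]
      congr 1
      simp [enorm_eq_nnnorm, nnnorm_prod]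
    simp_rw [h1]
    rw [e.tsum_eq (fun a => ∏ i, ‖y i (a i)‖ₑ ^ P.toReal),
      ENNReal.tsum_pi_prod n (fun i k => ‖y i k‖ₑ ^ P.toReal)]
    simp_rw [lp.enorm_rpow_eq_tsum hP]
  have hmem : ∀ y : Fin n → lp (fun _ : ℕ => 𝕜) P,
      Memℓp (fun a => ∏ i, y i (e a i)) P := fun y => by
    rw [memℓp_iff_tsum_enorm_rpow_ne_top hP, hsum]
    exact ENNReal.prod_ne_top fun i _ => ENNReal.rpow_ne_top_of_nonneg hP.le enorm_ne_top
  let co : ℕ → MultilinearMap 𝕜 (fun _ : Fin n => lp (fun _ : ℕ => 𝕜) P) 𝕜 := fun a =>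
    (MultilinearMap.mkPiAlgebra 𝕜 (Fin n) 𝕜).compLinearMap fun i =>
      (lp.evalCLM 𝕜 (fun _ : ℕ => 𝕜) P (e a i) : lp (fun _ : ℕ => 𝕜) P →ₗ[𝕜] 𝕜)
  have hco : ∀ a y, co a y = ∏ i, y i (e a i) := fun a y => by
    simp only [co, MultilinearMap.compLinearMap_apply, MultilinearMap.mkPiAlgebra_apply]
    rfl
  let Q₀ : MultilinearMap 𝕜 (fun _ : Fin n => lp (fun _ : ℕ => 𝕜) P) (lp (fun _ : ℕ => 𝕜) P) :=
    { toFun := fun y => ⟨fun a => ∏ i, y i (e a i), hmem y⟩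
      map_update_add' := fun {dec} y i u v => by
        cases Subsingleton.elim dec (instDecidableEqFin n)
        ext a
        have := (co a).map_update_add y i u v
        simp only [hco] at this
        exact this
      map_update_smul' := fun {dec} y i c u => by
        cases Subsingleton.elim dec (instDecidableEqFin n)
        ext a
        have := (co a).map_update_smul y i c u
        simp only [hco] at this
        exact this }
  have hQ₀ : ∀ y, ‖Q₀ y‖ₑ = ∏ i, ‖y i‖ₑ := fun y => by
    have h1 : ‖Q₀ y‖ₑ ^ P.toReal = (∏ i, ‖y i‖ₑ) ^ P.toReal := by
      rw [lp.enorm_rpow_eq_tsum hP, ← ENNReal.prod_rpow_of_nonneg hP.le, ← hsum]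
      rfl
    exact (ENNReal.rpow_left_injective hP.ne') h1
  refine ⟨Q₀.mkContinuous 1 fun y => ?_, hQ₀⟩
  rw [one_mul, ← toReal_enorm, hQ₀, ENNReal.toReal_prod]
  simp

end TensorPower

/-! ### Reduction to gauges and to linear operators. -/

section MainTheorem

variable {𝕜 X Y : Type*} [RCLike 𝕜] [NormedAddCommGroup X] [NormedSpace 𝕜 X]
  [NormedAddCommGroup Y] [NormedSpace 𝕜 Y]

theorem ENNReal.toReal_div_natCast (q : ℝ≥0∞) (n : ℕ) : (q / n).toReal = (n : ℝ)⁻¹ * q.toReal := by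
  rw [ENNReal.toReal_div, ENNReal.toReal_natCast, inv_mul_eq_div]

theorem mem_summingMultilinearMaps_iff {n : ℕ} (hn : 1 ≤ n) {q : ℝ≥0∞} (hq : 0 < q.toReal)
    {T : ContinuousMultilinearMap 𝕜 (fun _ : Fin n => X) Y} :
    T ∈ summingMultilinearMaps 𝕜 X Y n (q / n) q ↔
      IsSummingGauge 𝕜 (fun w => ‖T w‖ₑ ^ (n : ℝ)⁻¹) q.toReal := by
  have hqn : 0 < (q / n).toReal := by
    rw [ENNReal.toReal_div_natCast]; positivity
  simp only [summingMultilinearMaps, Set.mem_ofPred_eq, weaklySummableSeq_iff hq,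
    memℓp_iff_tsum_enorm_rpow_ne_top hqn, IsSummingGauge, ← ENNReal.rpow_mul,
    ENNReal.toReal_div_natCast]
  exact ⟨fun h x hx => h (fun s j => x j s) fun s ψ => hx ψ s,
    fun h x hx => h (fun j s => x s j) fun ψ s => hx s ψ⟩

theorem mem_summingPolynomials_iff {n : ℕ} (hn : 1 ≤ n) {q : ℝ≥0∞} (hq : 0 < q.toReal)
    {P : X → Y} :
    P ∈ summingPolynomials 𝕜 X Y n (q / n) q ↔ IsContinuousHomogeneousPolynomial 𝕜 n P ∧
      IsSummingGauge 𝕜 (fun w : Unit → X => ‖P (w ())‖ₑ ^ (n : ℝ)⁻¹) q.toReal := by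
  have hqn : 0 < (q / n).toReal := by
    rw [ENNReal.toReal_div_natCast]; positivity
  simp only [summingPolynomials, Set.mem_ofPred_eq, weaklySummableSeq_iff hq,
    memℓp_iff_tsum_enorm_rpow_ne_top hqn, IsSummingGauge, ← ENNReal.rpow_mul,
    ENNReal.toReal_div_natCast]
  exact and_congr_right fun _ => ⟨fun h x hx => h (fun j => x j ()) fun ψ => hx ψ (),
    fun h x hx => h (fun j _ => x j) fun ψ _ => hx ψ⟩

theorem enorm_multilinear_smul_rpow {n : ℕ} (hn : 1 ≤ n)
    (T : ContinuousMultilinearMap 𝕜 (fun _ : Fin n => X) Y) (c : 𝕜) (w : Fin n → X) :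
    ‖T (c • w)‖ₑ ^ (n : ℝ)⁻¹ = ‖c‖ₑ * ‖T w‖ₑ ^ (n : ℝ)⁻¹ := by
  have hn0 : (n : ℝ) ≠ 0 := by positivity
  have h1 : T (c • w) = c ^ n • T w := by
    have := T.map_smul_univ (fun _ => c) w
    rw [Finset.prod_const, Finset.card_univ, Fintype.card_fin] at this
    exact this
  rw [h1, enorm_smul_rpow (by positivity), enorm_pow, ← ENNReal.rpow_natCast, ← ENNReal.rpow_mul,
    mul_inv_cancel₀ hn0, ENNReal.rpow_one]

theorem summingMultilinearMaps_extrapolation {n : ℕ} (hn : 1 ≤ n) {P : ℝ≥0∞} [Fact (1 ≤ P)]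
    {r : ℝ} (hr : 1 < r) (hrP : r < P.toReal)
    (hlin : ∀ u : X →L[𝕜] lp (fun _ : ℕ => 𝕜) P,
      IsSummingGauge 𝕜 (fun w : Unit → X => ‖u (w ())‖ₑ) P.toReal →
      IsSummingGauge 𝕜 (fun w : Unit → X => ‖u (w ())‖ₑ) r) :
    summingMultilinearMaps 𝕜 X Y n (P / n) P = summingMultilinearMaps 𝕜 X Y n (1 / n) 1 := by
  ext T
  rw [mem_summingMultilinearMaps_iff hn (by linarith), mem_summingMultilinearMaps_iff hn (by simp),
    ENNReal.toReal_one]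
  exact isSummingGauge_iff_one hr hrP hlin (enorm_multilinear_smul_rpow hn T)
    fun w => ENNReal.rpow_ne_top_of_nonneg (by positivity) enorm_ne_top

theorem summingPolynomials_extrapolation {n : ℕ} (hn : 1 ≤ n) {P : ℝ≥0∞} [Fact (1 ≤ P)]
    {r : ℝ} (hr : 1 < r) (hrP : r < P.toReal)
    (hlin : ∀ u : X →L[𝕜] lp (fun _ : ℕ => 𝕜) P,
      IsSummingGauge 𝕜 (fun w : Unit → X => ‖u (w ())‖ₑ) P.toReal →
      IsSummingGauge 𝕜 (fun w : Unit → X => ‖u (w ())‖ₑ) r) :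
    summingPolynomials 𝕜 X Y n (P / n) P = summingPolynomials 𝕜 X Y n (1 / n) 1 := by
  ext R
  rw [mem_summingPolynomials_iff hn (by linarith), mem_summingPolynomials_iff hn (by simp),
    ENNReal.toReal_one]
  refine and_congr_right fun ⟨T, hT⟩ => ?_
  simp only [hT]
  exact isSummingGauge_iff_one hr hrP hlin
    (fun c w => enorm_multilinear_smul_rpow hn T c fun _ => w ())
    fun w => ENNReal.rpow_ne_top_of_nonneg (by positivity) enorm_ne_top

/-- The `n`-th root of a tensor power of norms is dominated by the sum of the norms, hence is a
summing gauge whenever the norm of the linear factor is. -/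
theorem IsSummingGauge.prod {n : ℕ} (hn : 1 ≤ n) {q : ℝ} (hq : 0 < q) {g : X → ℝ≥0∞}
    (hg : IsSummingGauge 𝕜 (fun w : Unit → X => g (w ())) q) :
    IsSummingGauge 𝕜 (fun w : Fin n → X => (∏ i, g (w i)) ^ (n : ℝ)⁻¹) q := by
  intro x hx
  have hn0 : (n : ℝ) ≠ 0 := by positivity
  have hle : ∀ j, ((∏ i, g (x j i)) ^ (n : ℝ)⁻¹) ^ q ≤ ∑ i, g (x j i) ^ q := fun j => by
    rw [← ENNReal.rpow_mul, mul_comm, ENNReal.rpow_mul, ← ENNReal.prod_rpow_of_nonneg hq.le,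
      ENNReal.rpow_inv_le_iff (by positivity), ENNReal.rpow_natCast]
    calc ∏ i, g (x j i) ^ q ≤ ∏ _i : Fin n, ∑ i, g (x j i) ^ q :=
          Finset.prod_le_prod' fun i _ => Finset.single_le_sum
            (f := fun i => g (x j i) ^ q) (fun _ _ => zero_le) (Finset.mem_univ i)
      _ = _ := by simp
  refine ne_top_of_le_ne_top ?_ (ENNReal.tsum_le_tsum hle)
  rw [Summable.tsum_finsetSum fun _ _ => ENNReal.summable]
  exact ENNReal.sum_ne_top.2 fun i _ => hg (fun j _ => x j i) fun ψ _ => hx ψ i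

/-- Test the inclusion on `Q ∘ (u, …, u)`: its gauge is the geometric mean of the `‖u (w i)‖`, which
is `p`-summing when `u` is and gives back `‖u x‖` on the diagonal. -/
theorem linear_of_summingMultilinearMaps_subset {n : ℕ} (hn : 1 ≤ n) {r P : ℝ≥0∞} [Fact (1 ≤ P)]
    (hr : 0 < r.toReal) (hP : 0 < P.toReal)
    (h : summingMultilinearMaps 𝕜 X (lp (fun _ : ℕ => 𝕜) P) n (P / n) P ⊆
      summingMultilinearMaps 𝕜 X (lp (fun _ : ℕ => 𝕜) P) n (r / n) r)
    (u : X →L[𝕜] lp (fun _ : ℕ => 𝕜) P)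
    (hu : IsSummingGauge 𝕜 (fun w : Unit → X => ‖u (w ())‖ₑ) P.toReal) :
    IsSummingGauge 𝕜 (fun w : Unit → X => ‖u (w ())‖ₑ) r.toReal := by
  have hn0 : (n : ℝ) ≠ 0 := by positivity
  obtain ⟨Q, hQ⟩ := exists_multilinear_lp_enorm_eq_prod 𝕜 hn hP
  have hmem := @h (Q.compContinuousLinearMap fun _ => u)
  simp only [mem_summingMultilinearMaps_iff hn hP, mem_summingMultilinearMaps_iff hn hr,
    ContinuousMultilinearMap.compContinuousLinearMap_apply, hQ] at hmem
  intro x hx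
  have := hmem (hu.prod hn hP (g := fun x => ‖u x‖ₑ)) (fun j _ => x j ()) fun ψ _ => hx ψ ()
  simpa [← ENNReal.rpow_natCast, ← ENNReal.rpow_mul, hn0] using this

theorem linear_of_summingPolynomials_subset {n : ℕ} (hn : 1 ≤ n) {r P : ℝ≥0∞} [Fact (1 ≤ P)]
    (hr : 0 < r.toReal) (hP : 0 < P.toReal)
    (h : summingPolynomials 𝕜 X (lp (fun _ : ℕ => 𝕜) P) n (P / n) P ⊆
      summingPolynomials 𝕜 X (lp (fun _ : ℕ => 𝕜) P) n (r / n) r)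
    (u : X →L[𝕜] lp (fun _ : ℕ => 𝕜) P)
    (hu : IsSummingGauge 𝕜 (fun w : Unit → X => ‖u (w ())‖ₑ) P.toReal) :
    IsSummingGauge 𝕜 (fun w : Unit → X => ‖u (w ())‖ₑ) r.toReal := by
  have hn0 : (n : ℝ) ≠ 0 := by positivity
  obtain ⟨Q, hQ⟩ := exists_multilinear_lp_enorm_eq_prod 𝕜 hn hP
  have hmem := @h fun x => Q fun _ => u x
  simp only [mem_summingPolynomials_iff hn hP, mem_summingPolynomials_iff hn hr, hQ,
    Finset.prod_const, Finset.card_univ, Fintype.card_fin, ← ENNReal.rpow_natCast,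
    ← ENNReal.rpow_mul, mul_inv_cancel₀ hn0, ENNReal.rpow_one] at hmem
  exact (hmem ⟨⟨Q.compContinuousLinearMap fun _ => u, fun _ => rfl⟩, hu⟩).2

end MainTheorem


/- The instance `Fact (1 ≤ p)` follows from `hr` and `hrp`; it only provides the norm of `l_p`. -/
theorem mainTheorem4 {𝕜 : Type*} [RCLike 𝕜] (n : ℕ) (hn : 1 ≤ n)
    (r p : ℝ≥0∞) [Fact (1 ≤ p)] (hr : 1 < r) (hrp : r < p) (hp : p < ∞)
    (X : Type*) [NormedAddCommGroup X] [NormedSpace 𝕜 X] [CompleteSpace X] :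
    (summingPolynomials 𝕜 X (lp (fun _ : ℕ => 𝕜) p) n (p / n) p =
        summingPolynomials 𝕜 X (lp (fun _ : ℕ => 𝕜) p) n (r / n) r →
      ∀ (Y : Type*) [NormedAddCommGroup Y] [NormedSpace 𝕜 Y] [CompleteSpace Y],
        summingPolynomials 𝕜 X Y n (p / n) p = summingPolynomials 𝕜 X Y n (1 / n) 1) ∧
    (summingMultilinearMaps 𝕜 X (lp (fun _ : ℕ => 𝕜) p) n (p / n) p =
        summingMultilinearMaps 𝕜 X (lp (fun _ : ℕ => 𝕜) p) n (r / n) r →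
      ∀ (Y : Type*) [NormedAddCommGroup Y] [NormedSpace 𝕜 Y] [CompleteSpace Y],
        summingMultilinearMaps 𝕜 X Y n (p / n) p = summingMultilinearMaps 𝕜 X Y n (1 / n) 1) := by

  have hP : 0 < p.toReal := ENNReal.toReal_pos (by rintro rfl; simp at hrp) hp.ne
  have hrtop : r ≠ ∞ := (hrp.trans hp).ne
  have hr1 : 1 < r.toReal := by
    rw [← ENNReal.toReal_one]; exact (ENNReal.toReal_lt_toReal (by simp) hrtop).2 hr
  have hrp' : r.toReal < p.toReal := (ENNReal.toReal_lt_toReal hrtop hp.ne).2 hrp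
  have hr0 : 0 < r.toReal := by linarith
  refine ⟨fun h Y _ _ _ => ?_, fun h Y _ _ _ => ?_⟩
  · exact summingPolynomials_extrapolation hn hr1 hrp'
      (linear_of_summingPolynomials_subset hn hr0 hP h.subset)
  · exact summingMultilinearMaps_extrapolation hn hr1 hrp'
      (linear_of_summingMultilinearMaps_subset hn hr0 hP h.subset)
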